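/- For $z\in\mathbb C^n$ and $\lambda\in\mathbb R^n$ put $\langle z,\lambda\rangle=z_1\lambda_1+\dots+z_n\lambda_n$. An exponential sum on $\mathbb C^n$ is a finite $\mathbb C$-linear combination $f$ of functions $z\mapsto e^{\langle z,\lambda\rangle}$ with $\lambda\in\mathbb R^n$. Its spectrum $\operatorname{Sp} f$ is the (finite) set of those $\lambda\in\mathbb R^n$ at which the Bohr transform $$a(f,\lambda)=\lim_{s\to+\infty}\frac1{(2s)^n}\int_{|y_1|<s,\dots,|y_n|<s}e^{-\langle x+iy,\lambda\rangle}f(x+iy)\,dy\qquad(x\in\mathbb R^n\text{ arbitrary})$$ is non-zero, its Newton polytope is $\Gamma_f=\operatorname{conv}(\operatorname{Sp} f)$, its amoeba is $\mathcal F_f=\overline{\{\operatorname{Re} z: f(z)=0\}}\subseteq\mathbb R^n$, and its Ronkin number $\rho(f)$ is the number of connected components of $\mathbb R^n\setminus\mathcal F_f$. For a Laurent polynomial $P\in\mathbb C[\zeta_1^{\pm1},\dots,\zeta_r^{\pm1}]$, the Newton polytope $\Gamma_P\subset\mathbb R^r$ is the convex hull of the support of $P$ (the set of exponents with non-zero coefficient),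 the amoeba is $\mathcal A_P=\{(\ln|\zeta_1|,\dots,\ln|\zeta_r|):\zeta\in(\mathbb C^*)^r,\ P(\zeta)=0\}$, and $\rho(P)$ is the number of connected components of $\mathbb R^r\setminus\mathcal A_P$. A Laurent polynomial (resp. an exponential sum) is called maximally sparse if every point of its support (resp. of its spectrum) is a vertex of its Newton polytope. Its amoeba is called solid if the number of connected components of the complement of the amoeba equals the number of vertices of the Newton polytope. **Proposition.** Assume that the Passare–Rullgård conjecture holds, that is, for every $r$, every maximally sparse Laurent polynomial in $r$ variables has a solid amoeba. Then, for every $n$, every maximally sparse exponential sum $f$ on $\mathbb C^n$ has a solid amoeba, i.e. $\rho(f)$ equals the number of vertices of $\Gamma_f$. -/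

import Mathlib

open scoped BigOperators Topology
open Filter MeasureTheory

noncomputable section

namespace Amoeba

/-- The number of connected components of a subspace (`⊤` if there are infinitely many). -/
def numComponents {X : Type*} [TopologicalSpace X] (S : Set X) : ℕ∞ :=
  ENat.card (ConnectedComponents S)

/-- The set of vertices of a convex set. -/
def vertices {n : ℕ} (K : Set (Fin n → ℝ)) : Set (Fin n → ℝ) := K.extremePoints ℝ

/-! ### Exponential sums -/

/-- The bilinear pairing `⟨z, lam⟩ = z₁ lam₁ + ⋯ + zₙ lamₙ` (no conjugation), for `z` in `ℂⁿ` and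
`lam` in `ℝⁿ`. -/
def pairing {n : ℕ} (z : Fin n → ℂ) (lam : Fin n → ℝ) : ℂ := ∑ l, z l * (lam l : ℂ)

/-- Exponential sums on `ℂⁿ` with real frequencies: the `ℂ`-linear combinations of the functions
`z ↦ exp ⟨z, lam⟩`, `lam` in `ℝⁿ`. -/
def IsExpSum {n : ℕ} (f : (Fin n → ℂ) → ℂ) : Prop :=
  f ∈ Submodule.span ℂ
    (Set.range fun (lam : Fin n → ℝ) (z : Fin n → ℂ) => Complex.exp (pairing z lam))

/-- The point `x + i y` of `ℂⁿ`. -/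
def complexPoint {n : ℕ} (x y : Fin n → ℝ) : Fin n → ℂ := fun l => (x l : ℂ) + Complex.I * (y l : ℂ)

/-- The average of `exp (-⟨x + i y, lam⟩) f (x + i y)` over the cube `|y₁| < s, …, |yₙ| < s`. -/
def bohrMean {n : ℕ} (f : (Fin n → ℂ) → ℂ) (lam x : Fin n → ℝ) (s : ℝ) : ℂ :=
  (1 / (2 * (s : ℂ)) ^ n) *
    ∫ y in {y : Fin n → ℝ | ∀ l, |y l| < s},
      Complex.exp (-pairing (complexPoint x y) lam) * f (complexPoint x y)

/-- `a` is the value at `lam` of the Bohr transform of `f`, that is, the limit of the averages as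
`s → +∞`, which has to exist and to be the same for every `x`. -/
def HasBohrTransform {n : ℕ} (f : (Fin n → ℂ) → ℂ) (lam : Fin n → ℝ) (a : ℂ) : Prop :=
  ∀ x : Fin n → ℝ, Tendsto (bohrMean f lam x) atTop (𝓝 a)

/-- The spectrum of `f`: the set of frequencies at which the Bohr transform does not vanish. -/
def bohrSpectrum {n : ℕ} (f : (Fin n → ℂ) → ℂ) : Set (Fin n → ℝ) :=
  {lam | ∃ a : ℂ, a ≠ 0 ∧ HasBohrTransform f lam a}

/-- The Newton polytope of `f`: the convex hull of its spectrum. -/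
def newtonPolytope {n : ℕ} (f : (Fin n → ℂ) → ℂ) : Set (Fin n → ℝ) :=
  convexHull ℝ (bohrSpectrum f)

/-- The amoeba of `f`: the closure in `ℝⁿ` of the set of real parts of the zeros of `f`. -/
def amoeba {n : ℕ} (f : (Fin n → ℂ) → ℂ) : Set (Fin n → ℝ) :=
  closure ((fun (z : Fin n → ℂ) (l : Fin n) => (z l).re) '' {z | f z = 0})

/-- The Ronkin number of `f`: the number of connected components of the complement of its amoeba. -/
def ronkinNumber {n : ℕ} (f : (Fin n → ℂ) → ℂ) : ℕ∞ := numComponents (amoeba f)ᶜ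

/-- All the points of the spectrum are vertices of the Newton polytope. -/
def IsMaximallySparse {n : ℕ} (f : (Fin n → ℂ) → ℂ) : Prop :=
  bohrSpectrum f ⊆ vertices (newtonPolytope f)

/-- The number of components of the complement of the amoeba is the number of vertices of the
Newton polytope. -/
def HasSolidAmoeba {n : ℕ} (f : (Fin n → ℂ) → ℂ) : Prop :=
  ronkinNumber f = (vertices (newtonPolytope f)).encard

end Amoeba

/-! ### Laurent polynomials in several variables -/

/-- The Laurent polynomials in `r` variables with complex coefficients: the group algebra of `ℤʳ`,
in which `k` stands for the monomial `ζ₁ ^ k₁ ⋯ ζᵣ ^ kᵣ`. -/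
abbrev MvLaurent (r : ℕ) : Type := AddMonoidAlgebra ℂ (Fin r → ℤ)

namespace MvLaurent

/-- The value of a Laurent polynomial at a point of `(ℂ*)ʳ`. -/
def eval {r : ℕ} (P : MvLaurent r) (ζ : Fin r → ℂˣ) : ℂ :=
  ∑ k ∈ P.coeff.support, P.coeff k * ∏ l, (ζ l : ℂ) ^ (k l)

/-- The support of summation, as a subset of `ℝʳ`. -/
def realSupport {r : ℕ} (P : MvLaurent r) : Set (Fin r → ℝ) :=
  (fun (k : Fin r → ℤ) (l : Fin r) => (k l : ℝ)) '' (P.coeff.support : Set (Fin r → ℤ))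

/-- The Newton polytope of a Laurent polynomial: the convex hull of its support. -/
def newtonPolytope {r : ℕ} (P : MvLaurent r) : Set (Fin r → ℝ) :=
  convexHull ℝ (realSupport P)

/-- The amoeba of (the zero set of) `P`: the image of the zero set of `P` in `(ℂ*)ʳ` under the map
`Log ζ = (log |ζ₁|, …, log |ζᵣ|)`. -/
def amoeba {r : ℕ} (P : MvLaurent r) : Set (Fin r → ℝ) :=
  (fun (ζ : Fin r → ℂˣ) (l : Fin r) => Real.log ‖(ζ l : ℂ)‖) '' {ζ | P.eval ζ = 0}

/-- The Ronkin number of `P`: the number of connected components of the complement of its amoeba. -/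
def ronkinNumber {r : ℕ} (P : MvLaurent r) : ℕ∞ := Amoeba.numComponents (amoeba P)ᶜ

/-- All the points of the support of summation are vertices of the Newton polytope. -/
def IsMaximallySparse {r : ℕ} (P : MvLaurent r) : Prop :=
  realSupport P ⊆ Amoeba.vertices (newtonPolytope P)

/-- The number of components of the complement of the amoeba is the number of vertices of the
Newton polytope. -/
def HasSolidAmoeba {r : ℕ} (P : MvLaurent r) : Prop :=
  ronkinNumber P = (Amoeba.vertices (newtonPolytope P)).encard

end MvLaurent

/-- The statement of the Passare–Rullgård conjecture: in any number of variables, every maximally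
sparse Laurent polynomial has a solid amoeba. -/
def PassareRullgardConjecture : Prop :=
  ∀ (r : ℕ) (P : MvLaurent r), P.IsMaximallySparse → P.HasSolidAmoeba

end

/-! The subgroup of `ℝⁿ` generated by the spectrum of `f` is free of finite rank. In a ℤ-basis `μ`
of it, `f` becomes a Laurent polynomial `P` evaluated at the exponentials `exp ⟨z, μ l⟩`. A linear
functional that singles out a vertex of `Γ_f` singles out the matching exponent of `P`, so `P` is
again maximally sparse and the conjecture counts the components of the complement of its amoeba.

The transfer back rests on `amoeba_expSum`: the amoeba of `f` is the preimage of that of `P` under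
the linear map `frequencyMap μ`. By Kronecker's theorem (`denseRange_torusExp`) each fibre `x + iℝⁿ`
winds densely around the torus over `frequencyMap μ x`, and Hurwitz's theorem moves a zero on the
torus to a nearby zero of `f`; this is why the closure is needed.

Upper bound: complement components for `P` are convex (`segment_subset_compl_torusAmoeba`), so the
preimage of each is convex, hence connected, and `f` has no more components than `P`. Lower bound:
far out in the direction of a vertex its term dominates all the others, and winding numbers along
coordinate circles recover the dominant exponent, so distinct vertices give distinct components
(`IsDominant.eq_of_segment_subset`). -/

namespace Amoeba

open scoped Matrix

/-! ### Persistence of zeros and winding numbers -/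

/-- Hurwitz's theorem with a parameter. -/
theorem eventually_exists_zero_of_zero {V : Type*} [TopologicalSpace V] {H : V → ℂ → ℂ}
    (hcont : Continuous fun p : V × ℂ => H p.1 p.2) (hdiff : ∀ v, Differentiable ℂ (H v))
    {v₀ : V} {w₀ w₁ : ℂ} (h₀ : H v₀ w₀ = 0) (h₁ : H v₀ w₁ ≠ 0) {ε : ℝ} (hε : 0 < ε) :
    ∀ᶠ v in 𝓝 v₀, ∃ w, ‖w - w₀‖ < ε ∧ H v w = 0 := by
  have hiso : ∀ᶠ w in 𝓝[≠] w₀, H v₀ w ≠ 0 := by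
    have han : AnalyticOnNhd ℂ (H v₀) Set.univ := fun z _ => (hdiff v₀).analyticAt z
    rcases (han w₀ trivial).eventually_eq_zero_or_eventually_ne_zero with h | h
    · exact absurd (han.eqOn_zero_of_preconnected_of_eventuallyEq_zero
        isPreconnected_univ trivial h (Set.mem_univ w₁)) h₁
    · exact h
  obtain ⟨δ, hδ, hball⟩ := Metric.eventually_nhds_iff.1 (eventually_nhdsWithin_iff.1 hiso)
  obtain ⟨ρ, hρ, hρ'⟩ := exists_between (lt_min hδ hε)
  have hsphere : ∀ w ∈ Metric.sphere w₀ ρ, H v₀ w ≠ 0 := fun w hw => by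
    refine hball (by rw [Metric.mem_sphere.1 hw]; exact hρ'.trans_le (min_le_left _ _)) ?_
    rintro rfl
    simp at hw
    exact hρ.ne hw
  have hcv : ∀ v, Continuous (H v) := fun v => (hdiff v).continuous
  have hne : (Metric.sphere w₀ ρ).Nonempty := NormedSpace.sphere_nonempty.2 hρ.le
  obtain ⟨wm, hwm, hmin⟩ := (isCompact_sphere w₀ ρ).exists_isMinOn hne
    (hcv v₀).norm.continuousOn
  set m := ‖H v₀ wm‖ with hm
  have hm0 : 0 < m := norm_pos_iff.2 (hsphere wm hwm)
  have hev1 : ∀ᶠ v in 𝓝 v₀, ∀ w ∈ Metric.sphere w₀ ρ, m / 2 < ‖H v w‖ := by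
    refine (isCompact_sphere w₀ ρ).eventually_forall_of_forall_eventually fun w hw => ?_
    have : m / 2 < ‖H v₀ w‖ := (half_lt_self hm0).trans_le (hmin hw)
    exact hcont.norm.continuousAt.eventually (lt_mem_nhds this)
  have hev2 : ∀ᶠ v in 𝓝 v₀, ‖H v w₀‖ < m / 2 := by
    have hc : Continuous fun v => ‖H v w₀‖ :=
      (hcont.comp (Continuous.prodMk_left w₀)).norm
    refine hc.continuousAt.eventually (gt_mem_nhds ?_)
    simpa [h₀] using hm0
  filter_upwards [hev1, hev2] with v hv1 hv2
  by_contra! hcon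
  have hnz : ∀ w ∈ Metric.closedBall w₀ ρ, H v w ≠ 0 := fun w hw => hcon w <| by
    rw [← dist_eq_norm]
    exact (Metric.mem_closedBall.1 hw).trans_lt (hρ'.trans_le (min_le_right _ _))
  -- Maximum principle for `1 / H v`: it is at most `2 / m` on the circle, yet exceeds `2 / m` at
  -- the centre.
  have hd : DiffContOnCl ℂ (fun w => (H v w)⁻¹) (Metric.ball w₀ ρ) := by
    refine DifferentiableOn.diffContOnCl fun w hw => ?_
    rw [closure_ball _ hρ.ne'] at hw
    exact ((hdiff v w).inv (hnz w hw)).differentiableWithinAt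
  have hle := Complex.norm_le_of_forall_mem_frontier_norm_le Metric.isBounded_ball hd
    (C := 2 / m) (fun w hw => by
      rw [frontier_ball _ hρ.ne'] at hw
      rw [norm_inv, ← inv_div]
      exact inv_anti₀ (half_pos hm0) (hv1 w hw).le)
    (subset_closure (Metric.mem_ball_self hρ))
  rw [norm_inv, ← inv_div] at hle
  have h0 : 0 < ‖H v w₀‖ := norm_pos_iff.2 (hnz w₀ (Metric.mem_closedBall_self hρ.le))
  exact absurd ((inv_le_inv₀ h0 (half_pos hm0)).1 hle) (not_le.2 hv2)

/-- The exponential is a covering map, so a lift of a constant map from a connected space is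
constant. -/
theorem eq_of_continuous_of_exp_const {X : Type*} [TopologicalSpace X] [PreconnectedSpace X]
    {q : X → ℂ} (hq : Continuous q) (hexp : ∀ x y, Complex.exp (q x) = Complex.exp (q y))
    (x y : X) : q x = q y :=
  Complex.isCoveringMap_exp.const_of_comp hq (fun a b => Subtype.ext (hexp a b)) x y

/-- The increment over a period of a logarithm of `exp (i a θ) u`, where `u` is periodic and stays
in a disc that avoids the origin. -/
theorem log_increment {h u : ℝ → ℂ} {C : ℂ} {a : ℤ} (hh : Continuous h) (hu : Continuous u)
    (hper : u (2 * Real.pi) = u 0) (hdom : ∀ θ, ‖u θ - C‖ < ‖C‖)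
    (hexp : ∀ θ : ℝ, Complex.exp (h θ) = Complex.exp (Complex.I * (a * θ)) * u θ) :
    h (2 * Real.pi) - h 0 = 2 * Real.pi * Complex.I * a := by
  have hC : C ≠ 0 := by
    rintro rfl
    have := hdom 0
    rw [norm_zero] at this
    exact absurd this (not_lt.2 (norm_nonneg _))
  have hslit : ∀ θ, u θ / C ∈ Complex.slitPlane := fun θ => by
    refine Complex.ball_one_subset_slitPlane ?_
    rw [mem_ball_iff_norm, div_sub_one hC, norm_div, div_lt_one (norm_pos_iff.2 hC)]
    exact hdom θ
  have hlog : Continuous fun θ => Complex.log (u θ / C) :=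
    (hu.div_const C).clog hslit
  -- Removing `i a θ` and the principal logarithm of `u / C` from `h` leaves a function whose
  -- exponential is the constant `C`.
  have hconst := eq_of_continuous_of_exp_const
    (q := fun θ : ℝ => h θ - Complex.I * (a * θ) - Complex.log (u θ / C))
    (by fun_prop) (fun x y => by
      simp only [Complex.exp_sub, hexp, Complex.exp_log (Complex.slitPlane_ne_zero (hslit _))]
      have hx : u x ≠ 0 := fun h0 => Complex.slitPlane_ne_zero (hslit x) (by simp [h0])
      have hy : u y ≠ 0 := fun h0 => Complex.slitPlane_ne_zero (hslit y) (by simp [h0])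
      have := Complex.exp_ne_zero (Complex.I * (a * x))
      have := Complex.exp_ne_zero (Complex.I * (a * y))
      field_simp) (2 * Real.pi) 0
  simp only [hper] at hconst
  push_cast at hconst
  linear_combination hconst

/-- The winding number of a loop in `ℂ*` is invariant under homotopy, for loops that are
dominated by a monomial. -/
theorem winding_eq {G : ℝ → ℝ → ℂ} (hG : Continuous fun p : ℝ × ℝ => G p.1 p.2)
    (hne : ∀ t θ, G t θ ≠ 0) (hper : ∀ t, G t (2 * Real.pi) = G t 0)
    {u₀ u₁ : ℝ → ℂ} {C₀ C₁ : ℂ} {a₀ a₁ : ℤ} (hu₀ : Continuous u₀) (hu₁ : Continuous u₁)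
    (hper₀ : u₀ (2 * Real.pi) = u₀ 0) (hper₁ : u₁ (2 * Real.pi) = u₁ 0)
    (hdom₀ : ∀ θ, ‖u₀ θ - C₀‖ < ‖C₀‖) (hdom₁ : ∀ θ, ‖u₁ θ - C₁‖ < ‖C₁‖)
    (hG₀ : ∀ θ : ℝ, G 0 θ = Complex.exp (Complex.I * (a₀ * θ)) * u₀ θ)
    (hG₁ : ∀ θ : ℝ, G 1 θ = Complex.exp (Complex.I * (a₁ * θ)) * u₁ θ) : a₀ = a₁ := by
  have hsc : IsSimplyConnected (Set.univ : Set (ℝ × ℝ)) := by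
    have := (convex_univ (𝕜 := ℝ) (E := ℝ × ℝ)).contractibleSpace Set.univ_nonempty
    exact SimplyConnectedSpace.ofContractible _
  obtain ⟨h, hc, he⟩ := Complex.exists_continuousOn_eqOn_exp_comp hsc isOpen_univ
    hG.continuousOn (by rintro ⟨p, -, hp⟩; exact hne _ _ hp)
  have hc' : Continuous h := continuousOn_univ.1 hc
  have he' : ∀ t θ, Complex.exp (h (t, θ)) = G t θ := fun t θ => he (Set.mem_univ (t, θ))
  -- With a global logarithm `h` of `G`, periodicity makes the increment over a period a logarithm
  -- of `1`, hence independent of `t`.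
  have hconst := eq_of_continuous_of_exp_const
    (q := fun t : ℝ => h (t, 2 * Real.pi) - h (t, 0)) (by fun_prop)
    (fun x y => by simp [Complex.exp_sub, he', hper, div_self (hne _ _)]) 0 1
  have e₀ := log_increment (h := fun θ => h (0, θ)) (by fun_prop) hu₀ hper₀ hdom₀
    (fun θ => by rw [he', hG₀])
  have e₁ := log_increment (h := fun θ => h (1, θ)) (by fun_prop) hu₁ hper₁ hdom₁
    (fun θ => by rw [he', hG₁])
  rw [e₀, e₁] at hconst
  exact_mod_cast mul_left_cancel₀ Complex.two_pi_I_ne_zero hconst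

/-! ### Laurent polynomials in logarithmic coordinates: convexity and dominance -/

/-- The vector of `ℝʳ` with the given integer coordinates. -/
abbrev realExponent {r : ℕ} (k : Fin r → ℤ) : Fin r → ℝ := fun l => (k l : ℝ)

/-- The character `v ↦ v₁ ^ k₁ ⋯ vᵣ ^ kᵣ` of the torus. -/
noncomputable def torusCharacter {r : ℕ} (v : Fin r → Circle) (k : Fin r → ℤ) : Circle :=
  ∏ l, v l ^ k l

/-- The point `(exp (i θ₁), …, exp (i θᵣ))` of the torus. -/
noncomputable def torusExp {r : ℕ} (θ : Fin r → ℝ) : Fin r → Circle := fun l => Circle.exp (θ l)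

/-- The value of the Laurent polynomial `∑ i ∈ s, c i ζ ^ k i` at the point with the coordinates
`exp (X l) v l`. -/
noncomputable def torusSum {ι : Type*} {r : ℕ} (s : Finset ι) (c : ι → ℂ) (k : ι → Fin r → ℤ)
    (X : Fin r → ℝ) (v : Fin r → Circle) : ℂ :=
  ∑ i ∈ s, c i * (Real.exp (X ⬝ᵥ realExponent (k i)) : ℂ) * (torusCharacter v (k i) : ℂ)

/-- The amoeba of the Laurent polynomial `∑ i ∈ s, c i ζ ^ k i`. -/
def torusAmoeba {ι : Type*} {r : ℕ} (s : Finset ι) (c : ι → ℂ) (k : ι → Fin r → ℤ) :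
    Set (Fin r → ℝ) :=
  {X | ∃ v, torusSum s c k X v = 0}

/-- The restriction of a Laurent polynomial in exponential coordinates to a complex line with a
real direction `d`. -/
noncomputable def lineSum {ι : Type*} {r : ℕ} (s : Finset ι) (c : ι → ℂ) (k : ι → Fin r → ℤ)
    (X : Fin r → ℝ) (v : Fin r → Circle) (d : Fin r → ℝ) (w : ℂ) : ℂ :=
  ∑ i ∈ s, c i * (Real.exp (X ⬝ᵥ realExponent (k i)) : ℂ) * (torusCharacter v (k i) : ℂ) *
    Complex.exp (w * (d ⬝ᵥ realExponent (k i) : ℝ))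

section TorusSum

variable {ι : Type*} {r : ℕ} {s : Finset ι} {c : ι → ℂ} {k : ι → Fin r → ℤ}

@[fun_prop]
theorem continuous_torusCharacter (k : Fin r → ℤ) :
    Continuous fun v : Fin r → Circle => torusCharacter v k :=
  continuous_finsetProd _ fun l _ => (continuous_apply l).zpow (k l)

theorem torusCharacter_mul (v v' : Fin r → Circle) (k : Fin r → ℤ) :
    torusCharacter (v * v') k = torusCharacter v k * torusCharacter v' k := by
  simp [torusCharacter, mul_zpow, Finset.prod_mul_distrib]

theorem torusCharacter_torusExp (θ : Fin r → ℝ) (k : Fin r → ℤ) :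
    (torusCharacter (torusExp θ) k : ℂ) =
      Complex.exp ((θ ⬝ᵥ realExponent k : ℝ) * Complex.I) := by
  have hprod : (torusCharacter (torusExp θ) k : ℂ) = ∏ l, (Circle.exp (θ l) : ℂ) ^ k l :=
    map_prod Circle.coeHom _ _
  rw [hprod, dotProduct, Complex.ofReal_sum, Finset.sum_mul, Complex.exp_sum]
  refine Finset.prod_congr rfl fun l _ => ?_
  rw [Circle.coe_exp, ← Complex.exp_int_mul]
  push_cast
  ring_nf

@[fun_prop]
theorem continuous_dotProduct_const (d : Fin r → ℝ) :
    Continuous fun X : Fin r → ℝ => X ⬝ᵥ d := by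
  unfold dotProduct
  fun_prop

theorem continuous_torusSum :
    Continuous fun p : (Fin r → ℝ) × (Fin r → Circle) => torusSum s c k p.1 p.2 := by
  have h1 : ∀ d : Fin r → ℝ, Continuous fun p : (Fin r → ℝ) × (Fin r → Circle) => p.1 ⬝ᵥ d :=
    fun d => (continuous_dotProduct_const d).comp continuous_fst
  have h2 : ∀ d : Fin r → ℤ, Continuous fun p : (Fin r → ℝ) × (Fin r → Circle) =>
      (torusCharacter p.2 d : ℂ) :=
    fun d => continuous_subtype_val.comp ((continuous_torusCharacter d).comp continuous_snd)
  refine continuous_finsetSum _ fun i _ => ?_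
  have := h1 (realExponent (k i))
  have := h2 (k i)
  fun_prop

theorem continuous_lineSum (X : Fin r → ℝ) :
    Continuous fun p : ((Fin r → Circle) × (Fin r → ℝ)) × ℂ =>
      lineSum s c k X p.1.1 p.1.2 p.2 := by
  refine continuous_finsetSum _ fun i _ => ?_
  have h1 : Continuous fun p : ((Fin r → Circle) × (Fin r → ℝ)) × ℂ =>
      p.1.2 ⬝ᵥ realExponent (k i) :=
    (continuous_dotProduct_const _).comp (continuous_snd.comp continuous_fst)
  have h2 : Continuous fun p : ((Fin r → Circle) × (Fin r → ℝ)) × ℂ =>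
      (torusCharacter p.1.1 (k i) : ℂ) :=
    continuous_subtype_val.comp
      ((continuous_torusCharacter _).comp (continuous_fst.comp continuous_fst))
  fun_prop

theorem differentiable_lineSum (X : Fin r → ℝ) (v : Fin r → Circle) (d : Fin r → ℝ) :
    Differentiable ℂ (lineSum s c k X v d) := by
  unfold lineSum
  fun_prop

theorem lineSum_eq_torusSum (X : Fin r → ℝ) (v : Fin r → Circle) (d : Fin r → ℝ) (w : ℂ) :
    lineSum s c k X v d w = torusSum s c k (X + w.re • d) (v * torusExp (w.im • d)) := by
  refine Finset.sum_congr rfl fun i _ => ?_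
  rw [torusCharacter_mul, Circle.coe_mul, torusCharacter_torusExp, add_dotProduct,
    smul_dotProduct, smul_dotProduct, Real.exp_add, Complex.ofReal_mul]
  have : w * ((d ⬝ᵥ realExponent (k i) : ℝ) : ℂ) = ((w.re • (d ⬝ᵥ realExponent (k i)) : ℝ) : ℂ) +
      ((w.im • (d ⬝ᵥ realExponent (k i)) : ℝ) : ℂ) * Complex.I := by
    conv_lhs => rw [← Complex.re_add_im w]
    simp only [smul_eq_mul, Complex.ofReal_mul]
    ring
  rw [this, Complex.exp_add, Complex.ofReal_exp (_ • _)]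
  ring

/-- The torus is compact, so projecting the closed zero set along it gives a closed set. -/
theorem isClosed_torusAmoeba : IsClosed (torusAmoeba s c k) := by
  have h : IsClosed {p : (Fin r → ℝ) × (Fin r → Circle) | torusSum s c k p.1 p.2 = 0} :=
    isClosed_singleton.preimage continuous_torusSum
  convert isClosedMap_fst_of_compactSpace _ h
  ext X
  simp [torusAmoeba]

/-- The components of the complement of the amoeba of a Laurent polynomial are convex. -/
theorem segment_subset_compl_torusAmoeba {E : Set (Fin r → ℝ)} (hE : IsPreconnected E)
    (hsub : E ⊆ (torusAmoeba s c k)ᶜ) {a b : Fin r → ℝ} (ha : a ∈ E) (hb : b ∈ E) :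
    segment ℝ a b ⊆ (torusAmoeba s c k)ᶜ := by
  set A := torusAmoeba s c k with hA
  -- The points visible from `a` form an open set by compactness of the segment; it remains to show
  -- that it is relatively closed in `E`.
  let S : Set (Fin r → ℝ) := {b | ∀ t ∈ Set.Icc (0 : ℝ) 1, a + t • (b - a) ∈ Aᶜ}
  have hS : IsOpen S := by
    refine isOpen_iff_eventually.2 fun b hb => ?_
    refine isCompact_Icc.eventually_forall_of_forall_eventually fun t ht => ?_
    have hc : Continuous fun p : (Fin r → ℝ) × ℝ => a + p.2 • (p.1 - a) := by fun_prop
    exact hc.continuousAt.eventually (isClosed_torusAmoeba.isOpen_compl.mem_nhds (hb t ht))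
  have hES : E ⊆ S := by
    refine hE.subset_of_closure_inter_subset hS ⟨a, ha, fun t _ => by simpa using hsub ha⟩ ?_
    rintro b ⟨hbS, hbE⟩ t₀ ht₀ ⟨v, hv⟩
    have hline : ∀ (b' : Fin r → ℝ) (w : ℂ), lineSum s c k a (v) (b' - a) w = 0 →
        a + w.re • (b' - a) ∈ A := fun b' w hw => ⟨_, (lineSum_eq_torusSum _ _ _ _).symm.trans hw⟩
    have ht0 : 0 < t₀ := ht₀.1.lt_of_ne (by
      rintro rfl
      exact hsub ha ⟨v, by simpa using hv⟩)
    have ht1 : t₀ < 1 := ht₀.2.lt_of_ne (by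
      rintro rfl
      exact hsub hbE ⟨v, by simpa using hv⟩)
    -- A limit point `b` with a zero over an interior point of the segment would force zeros over
    -- the segments to nearby `b'`; since `0 < t₀ < 1`, the parameter stays in `[0, 1]`, which
    -- contradicts `b' ∈ S`.
    have hev := eventually_exists_zero_of_zero
      (H := fun (b' : Fin r → ℝ) w => lineSum s c k a v (b' - a) w) (v₀ := b)
      ((continuous_lineSum a).comp (f := fun p : (Fin r → ℝ) × ℂ => ((v, p.1 - a), p.2))
        (by fun_prop))
      (fun b' => differentiable_lineSum _ _ _) (w₀ := (t₀ : ℂ)) (w₁ := 0)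
      (by
        rw [lineSum_eq_torusSum]
        convert hv using 2
        · simp
        · ext l
          simp [torusExp])
      (fun h0 => hsub ha (by simpa using hline b 0 h0)) (lt_min ht0 (sub_pos.2 ht1))
    obtain ⟨b', hb'S, w, hw, hw0⟩ := ((mem_closure_iff_frequently.1 hbS).and_eventually hev).exists
    have hre : |w.re - t₀| < min t₀ (1 - t₀) := by
      refine lt_of_le_of_lt ?_ hw
      simpa using Complex.abs_re_le_norm (w - t₀)
    rw [abs_lt] at hre
    have h1 := min_le_left t₀ (1 - t₀)
    have h2 := min_le_right t₀ (1 - t₀)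
    exact hb'S w.re ⟨by linarith, by linarith⟩ (hline b' w hw0)
  rw [segment_eq_image']
  rintro _ ⟨t, ht, rfl⟩
  exact hES hb t ht

/-- The term with the index `i` is larger than the sum of all the others over the point `X`. -/
def IsDominant [DecidableEq ι] (s : Finset ι) (c : ι → ℂ) (k : ι → Fin r → ℤ) (X : Fin r → ℝ)
    (i : ι) : Prop :=
  i ∈ s ∧ ∑ j ∈ s.erase i, ‖c j‖ * Real.exp (X ⬝ᵥ realExponent (k j)) <
    ‖c i‖ * Real.exp (X ⬝ᵥ realExponent (k i))

theorem IsDominant.norm_sub_lt [DecidableEq ι] {X : Fin r → ℝ} {i : ι}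
    (h : IsDominant s c k X i) (v : Fin r → Circle) :
    ‖torusSum s c k X v -
        c i * (Real.exp (X ⬝ᵥ realExponent (k i)) : ℂ) * (torusCharacter v (k i) : ℂ)‖ <
      ‖c i * (Real.exp (X ⬝ᵥ realExponent (k i)) : ℂ)‖ := by
  rw [torusSum, ← Finset.add_sum_erase _ _ h.1, add_sub_cancel_left]
  refine (norm_sum_le _ _).trans_lt ?_
  simpa [abs_of_pos, Real.exp_pos, -Complex.ofReal_exp, Circle.norm_coe] using h.2

theorem IsDominant.notMem_torusAmoeba [DecidableEq ι] {X : Fin r → ℝ} {i : ι}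
    (h : IsDominant s c k X i) : X ∉ torusAmoeba s c k := by
  rintro ⟨v, hv⟩
  have := h.norm_sub_lt v
  rw [hv, zero_sub, norm_neg, norm_mul, Circle.norm_coe, mul_one] at this
  exact lt_irrefl _ this

theorem torusCharacter_mulSingle (l : Fin r) (u : Circle) (k : Fin r → ℤ) :
    torusCharacter (Pi.mulSingle l u) k = u ^ k l := by
  rw [torusCharacter, Finset.prod_eq_single l (fun j _ hj => by simp [hj]) (by simp)]
  simp

/-- Dominance by different exponents occurs in different components of the complement of the
amoeba. -/
theorem IsDominant.eq_of_segment_subset [DecidableEq ι] {X Y : Fin r → ℝ} {i j : ι}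
    (hX : IsDominant s c k X i) (hY : IsDominant s c k Y j)
    (hseg : segment ℝ X Y ⊆ (torusAmoeba s c k)ᶜ) : k i = k j := by
  ext l
  -- Loops in the `l`-th coordinate, with the base point moving from `X` to `Y`. Clamping `t` to
  -- `[0, 1]` keeps `G` free of zeros on the whole plane. The winding numbers at the two ends are
  -- the `l`-th entries of the dominant exponents.
  let G : ℝ → ℝ → ℂ := fun t θ =>
    torusSum s c k (X + (max 0 (min t 1)) • (Y - X)) (Pi.mulSingle l (Circle.exp θ))
  have hcoe : ∀ (θ : ℝ) (m : Fin r → ℤ),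
      (torusCharacter (Pi.mulSingle l (Circle.exp θ)) m : ℂ) =
        Complex.exp (Complex.I * (m l * θ)) := fun θ m => by
    rw [torusCharacter_mulSingle, Circle.coe_zpow, Circle.coe_exp, ← Complex.exp_int_mul]
    ring_nf
  have hG : Continuous fun p : ℝ × ℝ => G p.1 p.2 := by
    have h1 : Continuous fun p : ℝ × ℝ => Pi.mulSingle (M := fun _ : Fin r => Circle) l
        (Circle.exp p.2) :=
      (continuous_mulSingle l).comp (Circle.exp.continuous.comp continuous_snd)
    exact continuous_torusSum.comp (f := fun p : ℝ × ℝ => (X + (max 0 (min p.1 1)) • (Y - X),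
      Pi.mulSingle (M := fun _ : Fin r => Circle) l (Circle.exp p.2))) (by fun_prop)
  have hper : ∀ t, G t (2 * Real.pi) = G t 0 := fun t => by simp [G]
  have hne : ∀ t θ, G t θ ≠ 0 := fun t θ h0 => by
    refine hseg ?_ ⟨_, h0⟩
    rw [segment_eq_image']
    exact ⟨_, ⟨le_max_left _ _, max_le zero_le_one (min_le_right _ _)⟩, rfl⟩
  have hX0 : ∀ θ, G 0 θ = torusSum s c k X (Pi.mulSingle l (Circle.exp θ)) := fun θ => by
    simp [G]
  have hY1 : ∀ θ, G 1 θ = torusSum s c k Y (Pi.mulSingle l (Circle.exp θ)) := fun θ => by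
    simp [G]
  clear_value G
  have hexp0 : ∀ m : ℤ, Complex.exp (-(Complex.I * (m * (2 * Real.pi)))) = 1 := fun m => by
    rw [Complex.exp_eq_one_iff]
    exact ⟨-m, by push_cast; ring⟩
  have key : ∀ (Z : Fin r → ℝ) (i' : ι), IsDominant s c k Z i' → ∀ t : ℝ,
      (∀ θ, G t θ = torusSum s c k Z (Pi.mulSingle l (Circle.exp θ))) → ∀ θ : ℝ,
      ‖Complex.exp (-(Complex.I * (k i' l * θ))) * G t θ -
        c i' * (Real.exp (Z ⬝ᵥ realExponent (k i')) : ℂ)‖ <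
        ‖c i' * (Real.exp (Z ⬝ᵥ realExponent (k i')) : ℂ)‖ := by
    intro Z i' hZ t ht θ
    have h1 := hZ.norm_sub_lt (Pi.mulSingle l (Circle.exp θ))
    rw [← ht, hcoe] at h1
    refine lt_of_eq_of_lt ?_ h1
    have hn : ‖Complex.exp (-(Complex.I * (k i' l * θ)))‖ = 1 := by
      rw [Complex.norm_exp]
      simp
    rw [← one_mul ‖G t θ - _‖, ← hn, ← norm_mul, mul_sub, mul_left_comm _ (c i' * _),
      ← Complex.exp_add, neg_add_cancel, Complex.exp_zero, mul_one]
  have hcu : ∀ (m : ℤ) (t : ℝ), Continuous fun θ : ℝ =>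
      Complex.exp (-(Complex.I * (m * θ))) * G t θ := fun m t => by
    have : Continuous fun θ : ℝ => G t θ := hG.comp (f := fun θ => (t, θ)) (Continuous.prodMk_right t)
    fun_prop
  have hpu : ∀ (m : ℤ) (t : ℝ),
      Complex.exp (-(Complex.I * (m * ((2 * Real.pi : ℝ) : ℂ)))) * G t (2 * Real.pi) =
      Complex.exp (-(Complex.I * (m * ((0 : ℝ) : ℂ)))) * G t 0 := fun m t => by
    have := hexp0 m
    push_cast
    rw [hper, this]
    simp
  have hmul : ∀ (m : ℤ) (t θ : ℝ), G t θ =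
      Complex.exp (Complex.I * (m * θ)) * (Complex.exp (-(Complex.I * (m * θ))) * G t θ) := by
    intro m t θ
    rw [← mul_assoc, ← Complex.exp_add, add_neg_cancel, Complex.exp_zero, one_mul]
  exact winding_eq hG hne hper (hcu _ _) (hcu _ _) (hpu _ _) (hpu _ _)
    (key X i hX 0 hX0) (key Y j hY 1 hY1) (hmul _ _) (hmul _ _)

end TorusSum

/-! ### Bohr means and the spectrum of an exponential sum -/

/-- The exponential sum with the coefficients `c i` and the frequencies `ν i`. -/
noncomputable def expSum {ι : Type*} {n : ℕ} (s : Finset ι) (c : ι → ℂ) (ν : ι → Fin n → ℝ)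
    (z : Fin n → ℂ) : ℂ :=
  ∑ i ∈ s, c i * Complex.exp (pairing z (ν i))

theorem pairing_complexPoint {n : ℕ} (x y lam : Fin n → ℝ) :
    pairing (complexPoint x y) lam = (x ⬝ᵥ lam : ℝ) + (y ⬝ᵥ lam : ℝ) * Complex.I := by
  simp only [pairing, complexPoint, dotProduct, Complex.ofReal_sum, Finset.sum_mul,
    ← Finset.sum_add_distrib]
  refine Finset.sum_congr rfl fun l _ => ?_
  push_cast
  ring

theorem IsExpSum.exists_eq_expSum {n : ℕ} {f : (Fin n → ℂ) → ℂ} (hf : IsExpSum f) :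
    ∃ c : (Fin n → ℝ) →₀ ℂ, f = expSum c.support c id := by
  obtain ⟨c, rfl⟩ := (Finsupp.mem_span_range_iff_exists_finsupp).1 hf
  refine ⟨c, ?_⟩
  ext z
  simp [Finsupp.sum, expSum, Finset.sum_apply]

/-- The mean of `y ↦ exp (i y κ)` over `|y| < s`. -/
theorem tendsto_interval_mean_exp (κ : ℝ) :
    Tendsto (fun s : ℝ => (1 / (2 * (s : ℂ))) *
      ∫ y in Set.Ioo (-s) s, Complex.exp ((y * κ : ℝ) * Complex.I)) atTop
      (𝓝 (if κ = 0 then 1 else 0)) := by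
  have hint : ∀ s : ℝ, 0 < s → ∫ y in Set.Ioo (-s) s, Complex.exp ((y * κ : ℝ) * Complex.I) =
      ∫ y in (-s)..s, Complex.exp ((y * κ : ℝ) * Complex.I) := fun s hs => by
    rw [intervalIntegral.integral_of_le (by linarith), integral_Ioc_eq_integral_Ioo]
  split_ifs with hκ
  · refine tendsto_const_nhds.congr' ?_
    filter_upwards [eventually_gt_atTop 0] with s hs
    have hs' : (s : ℂ) ≠ 0 := Complex.ofReal_ne_zero.2 hs.ne'
    rw [hint s hs, hκ]
    simp
    field_simp
    norm_num
  · have hκ' : (κ : ℂ) * Complex.I ≠ 0 := mul_ne_zero (Complex.ofReal_ne_zero.2 hκ) Complex.I_ne_zero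
    have hbound : ∀ᶠ s : ℝ in atTop, ‖(1 / (2 * (s : ℂ))) *
        ∫ y in Set.Ioo (-s) s, Complex.exp ((y * κ : ℝ) * Complex.I)‖ ≤ |κ|⁻¹ * s⁻¹ := by
      filter_upwards [eventually_gt_atTop 0] with s hs
      have he : ∀ y : ℝ, Complex.exp ((y * κ : ℝ) * Complex.I) =
          Complex.exp ((κ : ℂ) * Complex.I * y) := fun y => by
        push_cast
        ring_nf
      rw [hint s hs]
      simp only [he]
      rw [integral_exp_mul_complex hκ', norm_mul, norm_div, norm_div]
      have h1 : ∀ t : ℝ, ‖Complex.exp ((κ : ℂ) * Complex.I * t)‖ = 1 := fun t => by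
        rw [Complex.norm_exp]
        simp
      have h2 := norm_sub_le (Complex.exp ((κ : ℂ) * Complex.I * s))
        (Complex.exp ((κ : ℂ) * Complex.I * (-s : ℝ)))
      rw [h1, h1] at h2
      have hκ0 : 0 < |κ| := abs_pos.2 hκ
      simp only [norm_mul, Complex.norm_I, Complex.norm_real, norm_one, mul_one,
        Real.norm_eq_abs, abs_of_pos hs, Complex.norm_ofNat]
      calc _ ≤ 1 / (2 * s) * ((1 + 1) / |κ|) := by gcongr
        _ = _ := by field_simp; norm_num
    refine squeeze_zero_norm' hbound ?_
    simpa using tendsto_inv_atTop_zero.const_mul (|κ|⁻¹)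

/-- The mean of `y ↦ exp (i ⟨y, κ⟩)` over the cube. -/
theorem tendsto_cube_mean_exp {n : ℕ} (κ : Fin n → ℝ) :
    Tendsto (fun s : ℝ => (1 / (2 * (s : ℂ)) ^ n) *
      ∫ y in {y : Fin n → ℝ | ∀ l, |y l| < s}, Complex.exp ((y ⬝ᵥ κ : ℝ) * Complex.I)) atTop
      (𝓝 (if κ = 0 then 1 else 0)) := by
  have hlim := tendsto_finsetProd Finset.univ
    fun (l : Fin n) _ => tendsto_interval_mean_exp (κ l)
  have hval : (∏ l, if κ l = 0 then (1 : ℂ) else 0) = if κ = 0 then 1 else 0 := by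
    split_ifs with h
    · simp [h]
    · obtain ⟨l, hl⟩ := Function.ne_iff.1 h
      exact Finset.prod_eq_zero (Finset.mem_univ l) (if_neg hl)
  rw [hval] at hlim
  refine hlim.congr fun s => ?_
  have hset : {y : Fin n → ℝ | ∀ l, |y l| < s} = Set.univ.pi fun _ => Set.Ioo (-s) s := by
    ext y
    simp [abs_lt]
  have hprod : ∀ y : Fin n → ℝ, Complex.exp ((y ⬝ᵥ κ : ℝ) * Complex.I) =
      ∏ l, Complex.exp ((y l * κ l : ℝ) * Complex.I) := fun y => by
    rw [← Complex.exp_sum, dotProduct, Complex.ofReal_sum, Finset.sum_mul]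
  simp only [hprod]
  rw [hset, volume_pi, Measure.restrict_pi_pi,
    integral_fintype_prod_eq_prod (f := fun (l : Fin n) (t : ℝ) =>
      Complex.exp ((t * κ l : ℝ) * Complex.I)), Finset.prod_mul_distrib,
    Finset.prod_const, Finset.card_univ, Fintype.card_fin, one_div_pow]

section

variable {ι : Type*} {n : ℕ} (s : Finset ι) (c : ι → ℂ) (ν : ι → Fin n → ℝ)

theorem bohrMean_expSum (lam x : Fin n → ℝ) (t : ℝ) :
    bohrMean (expSum s c ν) lam x t = ∑ i ∈ s, c i * (Real.exp (x ⬝ᵥ (ν i - lam)) : ℂ) *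
      ((1 / (2 * (t : ℂ)) ^ n) * ∫ y in {y : Fin n → ℝ | ∀ l, |y l| < t},
        Complex.exp ((y ⬝ᵥ (ν i - lam) : ℝ) * Complex.I)) := by
  have hterm : ∀ y : Fin n → ℝ, Complex.exp (-pairing (complexPoint x y) lam) *
      expSum s c ν (complexPoint x y) = ∑ i ∈ s, c i * (Real.exp (x ⬝ᵥ (ν i - lam)) : ℂ) *
        Complex.exp ((y ⬝ᵥ (ν i - lam) : ℝ) * Complex.I) := fun y => by
    rw [expSum, Finset.mul_sum]
    refine Finset.sum_congr rfl fun i _ => ?_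
    rw [Complex.ofReal_exp, mul_left_comm, mul_assoc, ← Complex.exp_add, ← Complex.exp_add,
      pairing_complexPoint, pairing_complexPoint, dotProduct_sub, dotProduct_sub]
    push_cast
    ring_nf
  have hbdd : {y : Fin n → ℝ | ∀ l, |y l| < t} ⊆ Metric.closedBall 0 |t| := fun y hy => by
    rw [mem_closedBall_zero_iff]
    exact (pi_norm_le_iff_of_nonneg (abs_nonneg t)).2 fun l => (hy l).le.trans (le_abs_self t)
  have hint : ∀ i ∈ s, IntegrableOn (fun y : Fin n → ℝ =>
      c i * (Real.exp (x ⬝ᵥ (ν i - lam)) : ℂ) *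
        Complex.exp ((y ⬝ᵥ (ν i - lam) : ℝ) * Complex.I))
      {y : Fin n → ℝ | ∀ l, |y l| < t} := fun i _ => by
    refine IntegrableOn.mono_set ?_ hbdd
    exact ContinuousOn.integrableOn_compact (isCompact_closedBall _ _) (by fun_prop)
  simp only [bohrMean, hterm]
  rw [integral_finsetSum _ hint, Finset.mul_sum]
  refine Finset.sum_congr rfl fun i _ => ?_
  rw [integral_const_mul]
  ring

/-- The characters with frequency `ν i - lam ≠ 0` average to zero. Repeated frequencies are allowed,
hence the sum over `i`. -/
theorem hasBohrTransform_expSum (lam : Fin n → ℝ) :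
    HasBohrTransform (expSum s c ν) lam (∑ i ∈ s, if ν i = lam then c i else 0) := by
  intro x
  have h := tendsto_finsetSum s fun i _ => (tendsto_cube_mean_exp (ν i - lam)).const_mul
    (c i * (Real.exp (x ⬝ᵥ (ν i - lam)) : ℂ))
  refine (h.congr fun t => (bohrMean_expSum s c ν lam x t).symm).trans_eq ?_
  congr 1
  refine Finset.sum_congr rfl fun i _ => ?_
  by_cases hi : ν i = lam
  · simp [hi]
  · simp [hi, sub_eq_zero]

theorem norm_bohrMean_le {f : (Fin n → ℂ) → ℂ} {C : ℝ}
    (hC : ∀ y, ‖f (complexPoint 0 y)‖ ≤ C) (lam : Fin n → ℝ) {t : ℝ} (ht : 0 < t) :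
    ‖bohrMean f lam 0 t‖ ≤ C := by
  have hset : {y : Fin n → ℝ | ∀ l, |y l| < t} = Set.univ.pi fun _ => Set.Ioo (-t) t := by
    ext y
    simp [abs_lt]
  have hvol : volume {y : Fin n → ℝ | ∀ l, |y l| < t} = ENNReal.ofReal ((2 * t) ^ n) := by
    rw [hset, volume_pi_pi]
    simp [ENNReal.ofReal_pow, ht.le, two_mul]
  have hle := norm_setIntegral_le_of_norm_le_const (μ := volume)
    (s := {y : Fin n → ℝ | ∀ l, |y l| < t}) (C := C)
    (f := fun y => Complex.exp (-pairing (complexPoint 0 y) lam) * f (complexPoint 0 y))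
    (by rw [hvol]; exact ENNReal.ofReal_lt_top) (fun y _ => by
      rw [norm_mul, Complex.norm_exp, pairing_complexPoint]
      simpa using hC y)
  rw [Measure.real, hvol, ENNReal.toReal_ofReal (by positivity)] at hle
  rw [bohrMean, norm_mul]
  have h1 : ‖1 / (2 * (t : ℂ)) ^ n‖ = 1 / (2 * t) ^ n := by
    simp [abs_of_pos ht]
  rw [h1]
  calc _ ≤ 1 / (2 * t) ^ n * (C * (2 * t) ^ n) := by gcongr
    _ = C := by field_simp

/-- Each coefficient is a limit of means over `iℝⁿ`, which cannot exceed a bound for the sum there.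
-/
theorem norm_coeff_le {C : ℝ} (hC : ∀ y, ‖expSum s c ν (complexPoint 0 y)‖ ≤ C)
    (hν : Set.InjOn ν s) {i : ι} (hi : i ∈ s) : ‖c i‖ ≤ C := by
  have h := hasBohrTransform_expSum s c ν (ν i) 0
  rw [Finset.sum_eq_single_of_mem i hi
    (fun j hj hji => if_neg fun he => hji (hν hj hi he)), if_pos rfl] at h
  refine le_of_tendsto h.norm ?_
  filter_upwards [eventually_gt_atTop 0] with t ht using norm_bohrMean_le hC _ ht

end

theorem bohrSpectrum_expSum {n : ℕ} (c : (Fin n → ℝ) →₀ ℂ) :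
    bohrSpectrum (expSum c.support c id) = c.support := by
  ext lam
  have h := hasBohrTransform_expSum c.support c id lam
  simp only [id, Finset.sum_ite_eq'] at h
  constructor
  · rintro ⟨a, ha, ha'⟩
    have := tendsto_nhds_unique (ha' 0) (h 0)
    by_contra hs
    exact ha (this.trans (if_neg hs))
  · intro hs
    rw [if_pos (Finset.mem_coe.1 hs)] at h
    exact ⟨_, Finsupp.mem_support_iff.1 hs, h⟩

/-! ### Kronecker's theorem by Bohr's method of powers -/

/-- If a sum of `m` unimodular numbers, one of which is `1`, has almost the norm `m`, then all
of them are close to `1`. -/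
theorem norm_sub_one_sq_lt {ι : Type*} [Fintype ι] {w : ι → ℂ} (hw : ∀ i, ‖w i‖ = 1)
    {i j : ι} (hi : w i = 1) {δ : ℝ} (hδ : 0 < δ) (hδ' : δ < 1)
    (h : Fintype.card ι - δ < ‖∑ i, w i‖) : ‖w j - 1‖ ^ 2 < 4 * δ := by
  classical
  rcases eq_or_ne j i with rfl | hj
  · rw [hi]
    simpa using hδ
  have hsum : ∑ i, w i = (w j + 1) + ∑ l ∈ (Finset.univ.erase i).erase j, w l := by
    rw [← Finset.add_sum_erase _ _ (Finset.mem_univ i),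
      ← Finset.add_sum_erase _ w (Finset.mem_erase.2 ⟨hj, Finset.mem_univ j⟩), hi]
    ring
  have hrest : ‖∑ l ∈ (Finset.univ.erase i).erase j, w l‖ ≤ Fintype.card ι - 2 := by
    refine (norm_sum_le _ _).trans (le_of_eq ?_)
    have h1 : ((Finset.univ.erase i).erase j).card + 2 = Fintype.card ι := by
      have e1 := Finset.card_erase_add_one (Finset.mem_erase.2 ⟨hj, Finset.mem_univ j⟩)
      have e2 := Finset.card_erase_add_one (Finset.mem_univ i)
      rw [Finset.card_univ] at e2
      omega
    simp only [hw, Finset.sum_const, nsmul_eq_mul, mul_one]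
    rw [← h1]
    push_cast
    ring
  have h2 : 2 - δ < ‖w j + 1‖ := by
    rw [hsum] at h
    have := norm_add_le (w j + 1) (∑ l ∈ (Finset.univ.erase i).erase j, w l)
    linarith
  -- This gives `‖w j - 1‖² = 4 - ‖w j + 1‖² < 4 - (2 - δ)² < 4δ`.
  have hpar := parallelogram_law_with_norm ℝ (w j) 1
  rw [hw, norm_one] at hpar
  nlinarith

/-- Suppose the sum of `m` terms is bounded by `q < m`. By `hμ` the frequencies in the expansion of
its `p`-th power are distinct, so every multinomial coefficient is at most `q ^ p`. They add up to
`m ^ p` but number at most `(p + 1) ^ m`, which is absurd for large `p`. -/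
theorem exists_lt_norm_sum {ι : Type*} [Fintype ι] [DecidableEq ι] {n : ℕ} {a : ι → ℂ}
    (ha : ∀ i, ‖a i‖ = 1) {μ : ι → Fin n → ℝ}
    (hμ : ∀ p : ℕ, Set.InjOn (fun k : ι → ℕ => ∑ i, k i • μ i)
      (Finset.piAntidiag Finset.univ p : Finset (ι → ℕ)))
    {q : ℝ} (hq0 : 0 < q) (hq : q < Fintype.card ι) :
    ∃ y, q < ‖expSum Finset.univ a μ (complexPoint 0 y)‖ := by
  by_contra! hcon
  have hpow : ∀ (p : ℕ) (z : Fin n → ℂ), expSum Finset.univ a μ z ^ p =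
      expSum (Finset.piAntidiag Finset.univ p)
        (fun k : ι → ℕ => (Nat.multinomial Finset.univ k : ℂ) * ∏ i, a i ^ k i)
        (fun k => ∑ i, k i • μ i) z := by
    intro p z
    rw [expSum, Finset.sum_pow_eq_sum_piAntidiag]
    refine Finset.sum_congr rfl fun k _ => ?_
    have hpair : pairing z (∑ i, k i • μ i) = ∑ i, (k i : ℂ) * pairing z (μ i) := by
      simp only [pairing, Finset.sum_apply, Pi.smul_apply, Complex.ofReal_sum, Finset.mul_sum]
      rw [Finset.sum_comm]
      refine Finset.sum_congr rfl fun _ _ => Finset.sum_congr rfl fun _ _ => ?_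
      rw [nsmul_eq_mul, Complex.ofReal_mul, Complex.ofReal_natCast]
      ring
    simp only [mul_pow, Finset.prod_mul_distrib, hpair, Complex.exp_sum, ← Complex.exp_nat_mul,
      mul_assoc]
  have hmult : ∀ p : ℕ, ∀ k ∈ (Finset.piAntidiag Finset.univ p : Finset (ι → ℕ)),
      (Nat.multinomial Finset.univ k : ℝ) ≤ q ^ p := by
    intro p k hk
    have := norm_coeff_le _ _ _ (C := q ^ p) (fun y => by
      rw [← hpow, norm_pow]
      exact pow_le_pow_left₀ (norm_nonneg _) (hcon y) p) (hμ p) hk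
    simpa [norm_prod, ha] using this
  have hcard : ∀ p : ℕ, (Finset.piAntidiag Finset.univ p : Finset (ι → ℕ)).card ≤
      (p + 1) ^ Fintype.card ι := by
    intro p
    have hsub : (Finset.piAntidiag Finset.univ p : Finset (ι → ℕ)) ⊆
        Fintype.piFinset fun _ => Finset.range (p + 1) := by
      intro k hk
      rw [Fintype.mem_piFinset]
      intro i
      rw [Finset.mem_range, Nat.lt_succ_iff, ← (Finset.mem_piAntidiag.1 hk).1]
      exact Finset.single_le_sum (fun _ _ => Nat.zero_le _) (Finset.mem_univ i)
    simpa using Finset.card_le_card hsub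
  set m := Fintype.card ι with hm
  have hm0 : (0 : ℝ) < m := hq0.trans hq
  have hle : ∀ p : ℕ, (m : ℝ) ^ p ≤ ((p : ℝ) + 1) ^ m * q ^ p := by
    intro p
    have h1 := Finset.sum_pow_eq_sum_piAntidiag Finset.univ (fun _ : ι => (1 : ℝ)) p
    simp only [Finset.sum_const, Finset.card_univ, nsmul_eq_mul, mul_one, one_pow,
      Finset.prod_const_one, ← hm] at h1
    rw [h1]
    refine (Finset.sum_le_card_nsmul _ _ _ (hmult p)).trans ?_
    rw [nsmul_eq_mul]
    have h2 : ((Finset.piAntidiag Finset.univ p : Finset (ι → ℕ)).card : ℝ) ≤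
        ((p : ℝ) + 1) ^ m := by exact_mod_cast hcard p
    gcongr
  have hx0 : 0 < q / m := div_pos hq0 hm0
  -- Shifting the index produces the factor `(p + 1) ^ m`; by `hle` the sequence tending to zero
  -- stays above `q / m`.
  have hlim := (tendsto_pow_const_mul_const_pow_of_abs_lt_one m (r := q / m)
    (by rw [abs_of_pos hx0, div_lt_one hm0]; exact hq)).comp (tendsto_add_atTop_nat 1)
  refine absurd (ge_of_tendsto' (b := q / m) hlim fun p => ?_) (not_le.2 hx0)
  simp only [Function.comp_apply, Nat.cast_add, Nat.cast_one]
  rw [pow_succ, div_pow, ← mul_assoc]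
  refine le_mul_of_one_le_left hx0.le ?_
  rw [← mul_div_assoc, one_le_div (pow_pos hm0 p)]
  exact hle p

/-- Kronecker's approximation theorem. -/
theorem denseRange_torusExp {r n : ℕ} {μ : Fin r → Fin n → ℝ} (hμ : LinearIndependent ℤ μ) :
    DenseRange fun y : Fin n → ℝ => torusExp fun l => y ⬝ᵥ μ l := by
  refine Metric.denseRange_iff.2 fun v ε hε => ?_
  -- The extra term `1` of frequency `0` fixes the common phase: an almost maximal sum makes every
  -- `(v l)⁻¹ exp (i ⟨y, μ l⟩)` close to `1`. The zero frequency does not spoil injectivity, as its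
  -- exponent is recovered from the total degree `p`.
  let a : Option (Fin r) → ℂ := fun o => o.elim 1 fun l => ((v l)⁻¹ : Circle)
  let μ' : Option (Fin r) → Fin n → ℝ := fun o => o.elim 0 μ
  have ha : ∀ o, ‖a o‖ = 1 := by
    rintro (_ | l)
    · simp [a]
    · simp only [a, Option.elim, Circle.norm_coe]
  obtain ⟨δ, hδ, hδ'⟩ := exists_between (lt_min one_pos (show 0 < ε ^ 2 / 4 by positivity))
  have hδ1 : δ < 1 := hδ'.trans_le (min_le_left _ _)
  have hδ2 : δ < ε ^ 2 / 4 := hδ'.trans_le (min_le_right _ _)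
  have hinj : ∀ p : ℕ, Set.InjOn (fun k : Option (Fin r) → ℕ => ∑ i, k i • μ' i)
      (Finset.piAntidiag Finset.univ p : Finset (Option (Fin r) → ℕ)) := by
    intro p k hk k' hk' he
    simp only [Fintype.sum_option, μ', Option.elim, smul_zero, zero_add] at he
    have hsome : ∀ l, k (some l) = k' (some l) := by
      have hli := Fintype.linearIndependent_iff.1 hμ (fun l => (k (some l) : ℤ) - k' (some l)) (by
        simp only [sub_smul, Finset.sum_sub_distrib, natCast_zsmul]
        rw [he, sub_self])
      intro l
      have := hli l
      omega
    have h1 := (Finset.mem_piAntidiag.1 hk).1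
    have h2 := (Finset.mem_piAntidiag.1 hk').1
    simp only [Fintype.sum_option, hsome] at h1 h2
    ext (_ | l)
    · omega
    · exact hsome l
  have hcard : (1 : ℝ) ≤ Fintype.card (Option (Fin r)) := by
    simp
  obtain ⟨y, hy⟩ := exists_lt_norm_sum ha hinj (q := Fintype.card (Option (Fin r)) - δ)
    (by linarith) (by linarith)
  refine ⟨y, (dist_pi_lt_iff hε).2 fun l => ?_⟩
  have hexp : ∀ o, Complex.exp (pairing (complexPoint 0 y) (μ' o)) =
      (Circle.exp (y ⬝ᵥ μ' o) : ℂ) := fun o => by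
    rw [pairing_complexPoint, Circle.coe_exp]
    simp
  have hlt := norm_sub_one_sq_lt
    (w := fun o => a o * Complex.exp (pairing (complexPoint 0 y) (μ' o)))
    (fun o => by rw [norm_mul, ha, hexp, Circle.norm_coe, one_mul]) (i := none) (j := some l)
    (by simp [a, μ', pairing]) hδ hδ1 hy
  simp only [hexp] at hlt
  have hdist : dist (v l) (torusExp (fun l => y ⬝ᵥ μ l) l) =
      ‖a (some l) * (Circle.exp (y ⬝ᵥ μ' (some l)) : ℂ) - 1‖ := by
    have hone : a (some l) * (v l : ℂ) = 1 := by
      simp [a]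
    rw [← hone, ← mul_sub, norm_mul, ha, one_mul, dist_comm]
    exact dist_eq_norm (Circle.exp (y ⬝ᵥ μ l) : ℂ) (v l : ℂ)
  rw [hdist]
  exact lt_of_pow_lt_pow_left₀ 2 hε.le (hlt.trans (by linarith))

/-! ### Vertices as strict maxima of linear functionals -/

section Convex

/-- A vertex of the convex hull of a finite set is the strict maximum of a linear function. -/
theorem exists_dotProduct_lt {n : ℕ} {s : Set (Fin n → ℝ)} (hs : s.Finite) {p : Fin n → ℝ}
    (hp : p ∈ (convexHull ℝ s).extremePoints ℝ) :
    ∃ u : Fin n → ℝ, ∀ q ∈ s, q ≠ p → u ⬝ᵥ q < u ⬝ᵥ p := by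
  have hnot : p ∉ convexHull ℝ (s \ {p}) := fun h =>
    (((convex_convexHull ℝ s).mem_extremePoints_iff_mem_sdiff_convexHull_sdiff).1 hp).2
      (convexHull_mono (Set.sdiff_subset_sdiff_left (subset_convexHull ℝ s)) h)
  obtain ⟨φ, b, h1, h2⟩ := geometric_hahn_banach_closed_point (convex_convexHull ℝ _)
    ((hs.subset Set.sdiff_subset).isClosed_convexHull ℝ) hnot
  have hφ : ∀ x : Fin n → ℝ, (fun l => φ (Pi.single l 1)) ⬝ᵥ x = φ x := fun x => by
    have := LinearMap.pi_apply_eq_sum_univ φ.toLinearMap x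
    simp only [ContinuousLinearMap.coe_coe, smul_eq_mul] at this
    rw [this, dotProduct]
    refine Finset.sum_congr rfl fun l _ => ?_
    rw [mul_comm]
    congr 2
    ext j
    simp [Pi.single_apply, eq_comm]
  refine ⟨fun l => φ (Pi.single l 1), fun q hq hqp => ?_⟩
  rw [hφ, hφ]
  exact (h1 q (subset_convexHull ℝ _ ⟨hq, hqp⟩)).trans h2

/-- The strict maximum of a linear function on a set is a vertex of the convex hull. -/
theorem mem_extremePoints_of_dotProduct_lt {n : ℕ} {s : Set (Fin n → ℝ)} {p u : Fin n → ℝ}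
    (hp : p ∈ s) (hu : ∀ q ∈ s, q ≠ p → u ⬝ᵥ q < u ⬝ᵥ p) :
    p ∈ (convexHull ℝ s).extremePoints ℝ := by
  -- An open half-space together with one boundary point is convex, so it contains the hull; the
  -- hull without `p` then lies in the open half-space.
  have hconv : Convex ℝ {x : Fin n → ℝ | x = p ∨ u ⬝ᵥ x < u ⬝ᵥ p} := by
    intro x hx y hy a b ha hb hab
    have hle : ∀ z, (z = p ∨ u ⬝ᵥ z < u ⬝ᵥ p) → u ⬝ᵥ z ≤ u ⬝ᵥ p := by
      rintro z (rfl | h)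
      exacts [le_rfl, h.le]
    have hval : u ⬝ᵥ (a • x + b • y) = a * (u ⬝ᵥ x) + b * (u ⬝ᵥ y) := by
      simp [dotProduct_add, dotProduct_smul]
    have hp' : u ⬝ᵥ p = a * (u ⬝ᵥ p) + b * (u ⬝ᵥ p) := by rw [← add_mul, hab, one_mul]
    rcases ha.eq_or_lt with rfl | ha'
    · obtain rfl : b = 1 := by linarith
      simpa using hy
    rcases hb.eq_or_lt with rfl | hb'
    · obtain rfl : a = 1 := by linarith
      simpa using hx
    have hxl := mul_le_mul_of_nonneg_left (hle x hx) ha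
    have hyl := mul_le_mul_of_nonneg_left (hle y hy) hb
    rcases hx with rfl | hx
    · rcases hy with rfl | hy
      · left
        rw [← add_smul, hab, one_smul]
      · right
        rw [hval]
        have := mul_lt_mul_of_pos_left hy hb'
        linarith
    · right
      rw [hval]
      have := mul_lt_mul_of_pos_left hx ha'
      linarith
  have hsub : convexHull ℝ s ⊆ {x | x = p ∨ u ⬝ᵥ x < u ⬝ᵥ p} :=
    convexHull_min (fun q hq => (em (q = p)).imp id (hu q hq)) hconv
  have hhalf : Convex ℝ {x : Fin n → ℝ | u ⬝ᵥ x < u ⬝ᵥ p} :=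
    convex_halfSpace_lt ⟨dotProduct_add u, fun a x => dotProduct_smul a u x⟩ _
  rw [(convex_convexHull ℝ s).mem_extremePoints_iff_mem_sdiff_convexHull_sdiff]
  refine ⟨subset_convexHull ℝ s hp, fun h => ?_⟩
  have hlt := convexHull_min (fun x hx => (hsub hx.1).resolve_left hx.2) hhalf h
  exact lt_irrefl (u ⬝ᵥ p) hlt

end Convex

/-! ### Comparing numbers of connected components -/

section Components

theorem connectedComponents_coe_eq_coe_iff {X : Type*} [TopologicalSpace X] {S : Set X}
    {x y : S} : (x : ConnectedComponents S) = y ↔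
      ∃ T ⊆ S, IsPreconnected T ∧ (x : X) ∈ T ∧ (y : X) ∈ T := by
  rw [ConnectedComponents.coe_eq_coe']
  constructor
  · intro h
    exact ⟨Subtype.val '' connectedComponent y, Subtype.coe_image_subset _ _,
      isPreconnected_connectedComponent.image _ continuous_subtype_val.continuousOn,
      ⟨x, h, rfl⟩, ⟨y, mem_connectedComponent, rfl⟩⟩
  · rintro ⟨T, hTS, hT, hx, hy⟩
    have hpre : IsPreconnected (Subtype.val ⁻¹' T : Set S) := by
      rw [← Topology.IsInducing.subtypeVal.isPreconnected_image, Subtype.image_preimage_coe,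
        Set.inter_eq_right.2 hTS]
      exact hT
    exact hpre.subset_connectedComponent hy hx

theorem encard_le_card_connectedComponents {α X : Type*} [TopologicalSpace X] {S : Set X}
    {s : Set α} {p : α → X} (hp : ∀ a ∈ s, p a ∈ S)
    (h : ∀ T ⊆ S, IsPreconnected T → ∀ a ∈ s, ∀ b ∈ s, p a ∈ T → p b ∈ T → a = b) :
    s.encard ≤ ENat.card (ConnectedComponents S) := by
  refine ENat.card_le_card_of_injective
    (f := fun a : s => ((⟨p a, hp a a.2⟩ : S) : ConnectedComponents S)) fun a b hab => ?_
  obtain ⟨T, hTS, hT, ha, hb⟩ := connectedComponents_coe_eq_coe_iff.1 hab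
  exact Subtype.ext (h T hTS hT a a.2 b b.2 ha hb)

/-- The hypothesis `h` makes the map induced by `g` on components injective. -/
theorem card_connectedComponents_le {X Y : Type*} [TopologicalSpace X] [TopologicalSpace Y]
    {S : Set X} {S' : Set Y} {g : X → Y} (hg : Continuous g) (hmaps : Set.MapsTo g S S')
    (h : ∀ T ⊆ S', IsPreconnected T → ∀ a ∈ S, ∀ b ∈ S, g a ∈ T → g b ∈ T →
      ∃ T' ⊆ S, IsPreconnected T' ∧ a ∈ T' ∧ b ∈ T') :
    ENat.card (ConnectedComponents S) ≤ ENat.card (ConnectedComponents S') := by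
  have hg' : Continuous (hmaps.restrict g S S') := hg.restrict hmaps
  refine ENat.card_le_card_of_injective (f := hg'.connectedComponentsMap) fun a b hab => ?_
  obtain ⟨a, rfl⟩ := ConnectedComponents.surjective_coe a
  obtain ⟨b, rfl⟩ := ConnectedComponents.surjective_coe b
  obtain ⟨T, hTS, hT, ha, hb⟩ := connectedComponents_coe_eq_coe_iff.1
    (show (hmaps.restrict g S S' a : ConnectedComponents S') = hmaps.restrict g S S' b from hab)
  exact connectedComponents_coe_eq_coe_iff.2 (h T hTS hT a a.2 b b.2 ha hb)

end Components

/-! ### Passage from exponential sums to Laurent polynomials -/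

/-- Finitely many vectors have integer coordinates with respect to some vectors that are
independent over the integers. -/
theorem exists_integer_coordinates {n : ℕ} (s : Finset (Fin n → ℝ)) :
    ∃ (r : ℕ) (μ : Fin r → Fin n → ℝ) (k : (Fin n → ℝ) → Fin r → ℤ), LinearIndependent ℤ μ ∧
      ∀ lam ∈ s, ∑ l, (k lam l : ℝ) • μ l = lam := by
  classical
  -- A finitely generated torsion-free group is free; a basis provides `μ`. Coordinates of vectors
  -- outside `G` are set to `0`.
  let G := Submodule.span ℤ (s : Set (Fin n → ℝ))
  have : Module.Finite ℤ G := Module.Finite.span_of_finite ℤ s.finite_toSet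
  let b := Module.finBasis ℤ G
  refine ⟨_, fun l => (b l : Fin n → ℝ),
    fun lam => if h : lam ∈ G then fun l => b.repr ⟨lam, h⟩ l else 0,
    b.linearIndependent.map' G.subtype G.ker_subtype, fun lam hlam => ?_⟩
  have h : lam ∈ G := Submodule.subset_span hlam
  have := congrArg (G.subtype) (b.sum_repr ⟨lam, h⟩)
  rw [map_sum] at this
  simp only [h, dif_pos, Int.cast_smul_eq_zsmul]
  simpa using this

section LaurentPolynomial

variable {ι : Type*} {r : ℕ}

theorem eval_ofCoeff_mapDomain (c : ι →₀ ℂ) (k : ι → Fin r → ℤ) (ζ : Fin r → ℂˣ) :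
    MvLaurent.eval (AddMonoidAlgebra.ofCoeff (c.mapDomain k)) ζ =
      ∑ i ∈ c.support, c i * ∏ l, (ζ l : ℂ) ^ k i l :=
  Finsupp.sum_mapDomain_index (h := fun (m : Fin r → ℤ) (a : ℂ) => a * ∏ l, (ζ l : ℂ) ^ m l)
    (fun _ => zero_mul _) (fun _ _ _ => add_mul _ _ _)

theorem torusSum_eq_eval (c : ι →₀ ℂ) (k : ι → Fin r → ℤ) {X : Fin r → ℝ} {v : Fin r → Circle}
    {ζ : Fin r → ℂˣ} (h : ∀ l, (ζ l : ℂ) = (Real.exp (X l) : ℂ) * (v l : ℂ)) :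
    torusSum c.support c k X v = MvLaurent.eval (AddMonoidAlgebra.ofCoeff (c.mapDomain k)) ζ := by
  rw [eval_ofCoeff_mapDomain]
  refine Finset.sum_congr rfl fun i _ => ?_
  have hprod : (torusCharacter v (k i) : ℂ) = ∏ l, (v l : ℂ) ^ k i l :=
    map_prod Circle.coeHom _ _
  rw [hprod, dotProduct, Real.exp_sum, Complex.ofReal_prod, mul_assoc, ← Finset.prod_mul_distrib]
  congr 1
  refine Finset.prod_congr rfl fun l _ => ?_
  rw [h, mul_zpow, Complex.ofReal_exp, Complex.ofReal_exp, ← Complex.exp_int_mul]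
  push_cast
  ring_nf

theorem amoeba_ofCoeff_mapDomain (c : ι →₀ ℂ) (k : ι → Fin r → ℤ) :
    MvLaurent.amoeba (AddMonoidAlgebra.ofCoeff (c.mapDomain k)) =
      torusAmoeba c.support c k := by
  ext X
  constructor
  · rintro ⟨ζ, hζ, rfl⟩
    refine ⟨torusExp fun l => Complex.arg (ζ l), (torusSum_eq_eval c k fun l => ?_).trans hζ⟩
    rw [Real.exp_log (norm_pos_iff.2 (ζ l).ne_zero), torusExp, Circle.coe_exp,
      Complex.norm_mul_exp_arg_mul_I]
  · rintro ⟨v, hv⟩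
    have hne : ∀ l, (Real.exp (X l) : ℂ) * (v l : ℂ) ≠ 0 := fun l =>
      mul_ne_zero (Complex.ofReal_ne_zero.2 (Real.exp_ne_zero _)) (v l).coe_ne_zero
    refine ⟨fun l => Units.mk0 _ (hne l), ?_, ?_⟩
    · exact (torusSum_eq_eval c k fun l => rfl).symm.trans hv
    · ext l
      simp only [Units.val_mk0, norm_mul, Circle.norm_coe, mul_one, Complex.norm_real,
        Real.norm_eq_abs, Real.abs_exp, Real.log_exp]

/-- Injectivity of `k` on the support rules out cancellation between terms. -/
theorem realSupport_ofCoeff_mapDomain {c : ι →₀ ℂ} {k : ι → Fin r → ℤ}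
    (hk : Set.InjOn k c.support) :
    MvLaurent.realSupport (AddMonoidAlgebra.ofCoeff (c.mapDomain k)) =
      (fun i => realExponent (k i)) '' c.support := by
  classical
  rw [MvLaurent.realSupport, AddMonoidAlgebra.coeff_ofCoeff,
    Finsupp.mapDomain_support_of_injOn c hk, Finset.coe_image, Set.image_image]

end LaurentPolynomial

/-! ### The amoeba of an exponential sum as a linear section -/

section ExpSum

variable {n r : ℕ} {c : (Fin n → ℝ) →₀ ℂ} {μ : Fin r → Fin n → ℝ} {k : (Fin n → ℝ) → Fin r → ℤ}

/-- The linear map whose coordinates are the pairings with the vectors `μ l`. -/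
def frequencyMap (μ : Fin r → Fin n → ℝ) (x : Fin n → ℝ) : Fin r → ℝ := fun l => x ⬝ᵥ μ l

theorem continuous_frequencyMap : Continuous (frequencyMap μ) :=
  continuous_pi fun l => continuous_dotProduct_const (μ l)

theorem frequencyMap_add_smul (x d : Fin n → ℝ) (t : ℝ) :
    frequencyMap μ (x + t • d) = frequencyMap μ x + t • frequencyMap μ d := by
  ext l
  simp [frequencyMap, add_dotProduct, smul_dotProduct]

theorem frequencyMap_dotProduct (hk : ∀ lam ∈ c.support, ∑ l, (k lam l : ℝ) • μ l = lam)
    {lam : Fin n → ℝ} (hlam : lam ∈ c.support) (x : Fin n → ℝ) :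
    frequencyMap μ x ⬝ᵥ realExponent (k lam) = x ⬝ᵥ lam := by
  conv_rhs => rw [← hk lam hlam]
  rw [dotProduct_sum]
  refine Finset.sum_congr rfl fun l _ => ?_
  rw [dotProduct_smul, smul_eq_mul, mul_comm]
  rfl

theorem expSum_eq_torusSum (hk : ∀ lam ∈ c.support, ∑ l, (k lam l : ℝ) • μ l = lam)
    (x y : Fin n → ℝ) : expSum c.support c id (complexPoint x y) =
      torusSum c.support c k (frequencyMap μ x) (torusExp (frequencyMap μ y)) := by
  refine Finset.sum_congr rfl fun lam hlam => ?_
  rw [torusCharacter_torusExp, frequencyMap_dotProduct hk hlam, frequencyMap_dotProduct hk hlam,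
    pairing_complexPoint, Complex.exp_add, Complex.ofReal_exp, mul_assoc]
  rfl

/-- Far away in the direction in which it is maximal, every term is dominant. -/
theorem exists_isDominant (hk : ∀ lam ∈ c.support, ∑ l, (k lam l : ℝ) • μ l = lam)
    {lam : Fin n → ℝ} (hlam : lam ∈ c.support) {u : Fin n → ℝ}
    (hu : ∀ κ ∈ c.support, κ ≠ lam → u ⬝ᵥ κ < u ⬝ᵥ lam) :
    ∃ x, IsDominant c.support c k (frequencyMap μ x) lam := by
  -- Along the ray `t • u`, the other terms divided by the exponential of the leading one decay to
  -- zero.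
  have hlim : Tendsto (fun t : ℝ => ∑ κ ∈ c.support.erase lam,
      ‖c κ‖ * Real.exp (t * (u ⬝ᵥ κ - u ⬝ᵥ lam))) atTop (𝓝 0) := by
    rw [← Finset.sum_const_zero (s := c.support.erase lam)]
    refine tendsto_finsetSum _ fun κ hκ => ?_
    rw [← mul_zero ‖c κ‖]
    refine (Real.tendsto_exp_atBot.comp ?_).const_mul _
    have hneg := sub_neg.2 (hu κ (Finset.mem_of_mem_erase hκ) (Finset.ne_of_mem_erase hκ))
    exact tendsto_id.atTop_mul_const_of_neg hneg
  obtain ⟨t, ht⟩ := (hlim.eventually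
    (gt_mem_nhds (norm_pos_iff.2 (Finsupp.mem_support_iff.1 hlam)))).exists
  refine ⟨t • u, hlam, ?_⟩
  rw [frequencyMap_dotProduct hk hlam]
  have hsum : ∑ κ ∈ c.support.erase lam,
      ‖c κ‖ * Real.exp (frequencyMap μ (t • u) ⬝ᵥ realExponent (k κ)) =
      (∑ κ ∈ c.support.erase lam, ‖c κ‖ * Real.exp (t * (u ⬝ᵥ κ - u ⬝ᵥ lam))) *
        Real.exp (t • u ⬝ᵥ lam) := by
    rw [Finset.sum_mul]
    refine Finset.sum_congr rfl fun κ hκ => ?_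
    rw [frequencyMap_dotProduct hk (Finset.mem_of_mem_erase hκ), mul_assoc, ← Real.exp_add,
      smul_dotProduct, smul_dotProduct, smul_eq_mul, smul_eq_mul]
    ring_nf
  rw [hsum]
  exact mul_lt_mul_of_pos_right ht (Real.exp_pos _)

theorem amoeba_subset_preimage (hk : ∀ lam ∈ c.support, ∑ l, (k lam l : ℝ) • μ l = lam) :
    amoeba (expSum c.support c id) ⊆ frequencyMap μ ⁻¹' torusAmoeba c.support c k := by
  refine closure_minimal ?_ (isClosed_torusAmoeba.preimage continuous_frequencyMap)
  rintro _ ⟨z, hz, rfl⟩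
  refine ⟨_, (expSum_eq_torusSum hk (fun l => (z l).re) (fun l => (z l).im)).symm.trans ?_⟩
  rw [← hz.out]
  congr 1
  ext l
  rw [complexPoint, mul_comm, Complex.re_add_im]

/-- The amoeba of an exponential sum is a linear section of the amoeba of a Laurent polynomial. -/
theorem amoeba_expSum (hμ : LinearIndependent ℤ μ)
    (hk : ∀ lam ∈ c.support, ∑ l, (k lam l : ℝ) • μ l = lam)
    (hdom : ∀ lam ∈ c.support, ∃ x, IsDominant c.support c k (frequencyMap μ x) lam) :
    amoeba (expSum c.support c id) = frequencyMap μ ⁻¹' torusAmoeba c.support c k := by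
  refine (amoeba_subset_preimage hk).antisymm ?_
  rintro x ⟨v₀, hv₀⟩
  -- Without terms the sum is identically zero and its amoeba is the whole space. Otherwise a
  -- dominance point `x₁` gives a real direction along which the sum is not identically zero, as
  -- Hurwitz's theorem requires.
  rcases c.support.eq_empty_or_nonempty with hc | ⟨lam, hlam⟩
  · exact subset_closure ⟨complexPoint x 0, by simp [expSum, hc],
      by ext l; simp [complexPoint]⟩
  obtain ⟨x₁, hx₁⟩ := hdom lam hlam
  set d := x₁ - x with hd
  have hx₁d : x₁ = x + (1 : ℝ) • d := by simp [hd]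
  refine Metric.mem_closure_iff.2 fun ε hε => ?_
  have hline : ∀ v w, lineSum c.support c k (frequencyMap μ x) v (frequencyMap μ d) w =
      torusSum c.support c k (frequencyMap μ (x + w.re • d))
        (v * torusExp (w.im • frequencyMap μ d)) := fun v w => by
    rw [lineSum_eq_torusSum, frequencyMap_add_smul]
  have hev := eventually_exists_zero_of_zero
    (H := fun v w => lineSum c.support c k (frequencyMap μ x) v (frequencyMap μ d) w)
    (v₀ := v₀) (w₀ := 0) (w₁ := 1)
    ((continuous_lineSum (frequencyMap μ x)).comp
      (f := fun p : (Fin r → Circle) × ℂ => ((p.1, frequencyMap μ d), p.2)) (by fun_prop))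
    (fun v => differentiable_lineSum _ _ _)
    (by
      rw [hline]
      convert hv₀ using 2
      · simp
      · ext l
        simp [torusExp])
    (fun h0 => hx₁.notMem_torusAmoeba ⟨_, by
      rw [hline, Complex.one_re, ← hx₁d] at h0
      exact h0⟩)
    (show 0 < ε / (‖d‖ + 1) by positivity)
  -- Density replaces `v₀` by a point coming from some `y`. The zero `w` then moves the real part by
  -- `w.re • d`, of norm less than `ε`, and the imaginary part by `w.im • d`.
  obtain ⟨_, ⟨y, rfl⟩, hv⟩ := (denseRange_torusExp hμ).inter_nhds_nonempty hev
  obtain ⟨w, hw, hw0⟩ := hv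
  rw [hline] at hw0
  refine ⟨x + w.re • d, ⟨complexPoint (x + w.re • d) (y + w.im • d), ?_, ?_⟩, ?_⟩
  · rw [Set.mem_ofPred_eq, expSum_eq_torusSum hk, ← hw0, frequencyMap_add_smul]
    congr 1
    ext l
    simp [torusExp, frequencyMap, Circle.exp_add]
  · ext l
    simp [complexPoint]
  · rw [dist_self_add_right, norm_smul]
    have hre : |w.re| ≤ ‖w‖ := Complex.abs_re_le_norm w
    rw [sub_zero, lt_div_iff₀ (by positivity)] at hw
    rw [Real.norm_eq_abs]
    nlinarith [norm_nonneg d, norm_nonneg w]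

end ExpSum

end Amoeba

/-! ### The proposition -/

theorem mainTheorem4 (hPR : PassareRullgardConjecture) (n : ℕ) (f : (Fin n → ℂ) → ℂ)
    (hf : Amoeba.IsExpSum f) (hsparse : Amoeba.IsMaximallySparse f) :
    Amoeba.HasSolidAmoeba f := by
  open Amoeba in
  open scoped Matrix in
  obtain ⟨c, rfl⟩ := hf.exists_eq_expSum
  obtain ⟨r, μ, k, hμ, hk⟩ := exists_integer_coordinates c.support
  have hkinj : Set.InjOn k c.support := fun a ha b hb hab => by
    rw [← hk a ha, ← hk b hb, hab]
  rw [IsMaximallySparse, newtonPolytope, vertices, bohrSpectrum_expSum] at hsparse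
  have hvert : vertices (newtonPolytope (expSum c.support c id)) = c.support := by
    rw [vertices, newtonPolytope, bohrSpectrum_expSum]
    exact extremePoints_convexHull_subset.antisymm hsparse
  choose! u hu using fun (lam : Fin n → ℝ) (hlam : lam ∈ c.support) =>
    exists_dotProduct_lt c.support.finite_toSet (hsparse hlam)
  choose! x hx using fun (lam : Fin n → ℝ) (hlam : lam ∈ c.support) =>
    exists_isDominant hk hlam (hu lam hlam)
  have hA := amoeba_expSum hμ hk fun lam hlam => ⟨x lam, hx lam hlam⟩
  let P : MvLaurent r := AddMonoidAlgebra.ofCoeff (c.mapDomain k)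
  have hPsupp : P.realSupport = (fun lam => realExponent (k lam)) '' c.support :=
    realSupport_ofCoeff_mapDomain hkinj
  have hPsparse : P.IsMaximallySparse := by
    rw [MvLaurent.IsMaximallySparse, MvLaurent.newtonPolytope, hPsupp]
    rintro _ ⟨lam, hlam, rfl⟩
    -- This functional takes the value `u lam ⬝ᵥ κ` at the exponent of `κ`, so it inherits the
    -- strict maximum at `lam`.
    refine mem_extremePoints_of_dotProduct_lt (u := frequencyMap μ (u lam)) ⟨lam, hlam, rfl⟩ ?_
    rintro _ ⟨κ, hκ, rfl⟩ hne
    rw [frequencyMap_dotProduct hk hlam, frequencyMap_dotProduct hk hκ]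
    refine hu lam hlam κ hκ ?_
    rintro rfl
    exact hne rfl
  have hPcard : ENat.card (ConnectedComponents ((torusAmoeba c.support c k)ᶜ : Set _)) =
      (c.support : Set (Fin n → ℝ)).encard := by
    have h := hPR r P hPsparse
    rw [MvLaurent.HasSolidAmoeba, MvLaurent.ronkinNumber, numComponents,
      amoeba_ofCoeff_mapDomain] at h
    have hPvert : vertices P.newtonPolytope = P.realSupport :=
      extremePoints_convexHull_subset.antisymm hPsparse
    rw [h, hPvert, hPsupp]
    refine Set.InjOn.encard_image fun a ha b hb hab => hkinj ha hb (funext fun l => ?_)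
    exact_mod_cast congrFun hab l
  rw [HasSolidAmoeba, hvert, ronkinNumber, numComponents, hA]
  refine le_antisymm ?_ ?_
  -- Points with images in one component for `P` are joined by a segment, whose image is a segment
  -- avoiding the amoeba of `P`.
  · rw [← hPcard]
    refine card_connectedComponents_le continuous_frequencyMap (fun _ h => h) ?_
    intro T hTS hT a _ b _ ha hb
    refine ⟨segment ℝ a b, ?_, (convex_segment _ _).isPreconnected, left_mem_segment _ _ _,
      right_mem_segment _ _ _⟩
    intro y hy
    refine segment_subset_compl_torusAmoeba hT hTS ha hb ?_
    rw [segment_eq_image'] at hy ⊢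
    obtain ⟨t, ht, rfl⟩ := hy
    refine ⟨t, ht, ?_⟩
    ext l
    simp [frequencyMap, add_dotProduct, smul_dotProduct, sub_dotProduct]
  -- The dominance points of distinct frequencies lie in distinct components.
  · refine encard_le_card_connectedComponents (p := x)
      (fun a ha => (hx a ha).notMem_torusAmoeba) ?_
    intro T hTS hT a ha b hb haT hbT
    refine hkinj ha hb ((hx a ha).eq_of_segment_subset (hx b hb) ?_)
    refine segment_subset_compl_torusAmoeba (hT.image _ continuous_frequencyMap.continuousOn) ?_
      ⟨_, haT, rfl⟩ ⟨_, hbT, rfl⟩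
    rintro _ ⟨y, hy, rfl⟩
    exact hTS hy
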